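/- Let $d\ge 1$ be a square-free integer and $q=e^{2\pi i/d}$. Let $PF_\infty$ be the unital complex $*$-algebra generated by elements $c_1,c_2,c_3,\dots$ (parafermions) subject to the relations $$c_jc_k=q\,c_kc_j\quad (j<k),\qquad c_j^d=1,\qquad c_j^*=c_j^{-1}.$$ For $k\in\mathbb Z/d$, an element $x\in PF_\infty$ is said to have degree $k$ if it is a linear combination of monomials $c_{i_1}c_{i_2}\cdots c_{i_r}$ with $r\equiv k \pmod d$. Choose $\zeta\in\mathbb C$ with $\zeta^2=q$ and $\zeta^{d^2}=1$, and a square root $\omega^{1/2}$ of $\omega=\frac1{\sqrt d}\sum_{j=0}^{d-1}\zeta^{j^2}$. For $k\ge 1$ put $$\beta_k=\frac{\omega^{1/2}}{\sqrt d}\sum_{i=0}^{d-1}c_{k+1}^{-i}c_k^{\,i}\in PF_\infty ,$$ and for $j\ge 1$ let $$b_j=\beta_{2j}\,\beta_{2j-1}\,\beta_{2j+1}\,\beta_{2j}$$ be the four-string braid, which is invertible and satisfies $b_j\,(c_{2j-1}^{m}c_{2j}^{n})\,b_j^{-1}=c_{2j+1}^{m}c_{2j+2}^{n}$. Let $\mathbb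 B_\infty$ be the group generated by $b_1,b_2,\dots$ in the group of invertible elements of $PF_\infty$. A state on $PF_\infty$ is a linear functional $\varphi:PF_\infty\to\mathbb C$ with $\varphi(1)=1$ and $\varphi(x^*x)\ge 0$ for all $x$; it is braid invariant if $\varphi(bxb^{-1})=\varphi(x)$ for all $b\in\mathbb B_\infty$ and $x\in PF_\infty$. Theorem. Every braid-invariant state $\varphi$ on $PF_\infty$ is neutral: $\varphi(x)=0$ for every $x\in PF_\infty$ of degree $k\neq 0$ in $\mathbb Z/d$. -/

import Mathlib

open scoped ComplexOrder

noncomputable section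

namespace Parafermion

/-- The root of unity `q = exp (2 π i / d)`. -/
def q (d : ℕ) : ℂ := Complex.exp (2 * Real.pi * Complex.I / d)

lemma q_ne_zero (d : ℕ) : q d ≠ 0 := Complex.exp_ne_zero _

lemma star_q (d : ℕ) : star (q d) = (q d)⁻¹ := by
  rw [q, ← Complex.exp_neg, Complex.star_def, ← Complex.exp_conj]
  congr 1
  simp only [map_div₀, map_mul, Complex.conj_I, Complex.conj_ofReal, map_natCast, map_ofNat]
  ring

/-- The canonical parafermion relations, on the free unital complex algebra on symbols
`inl j` (for the generator `c_j`) and `inr j` (for its adjoint `c_j^*`). -/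
inductive Rel (d : ℕ) : FreeAlgebra ℂ (ℕ ⊕ ℕ) → FreeAlgebra ℂ (ℕ ⊕ ℕ) → Prop
  | comm (j k : ℕ) (h : j < k) :
      Rel d (FreeAlgebra.ι ℂ (Sum.inl j) * FreeAlgebra.ι ℂ (Sum.inl k))
        (q d • (FreeAlgebra.ι ℂ (Sum.inl k) * FreeAlgebra.ι ℂ (Sum.inl j)))
  | pow (j : ℕ) : Rel d (FreeAlgebra.ι ℂ (Sum.inl j) ^ d) 1
  | adjoint_mul (j : ℕ) :
      Rel d (FreeAlgebra.ι ℂ (Sum.inr j) * FreeAlgebra.ι ℂ (Sum.inl j)) 1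
  | mul_adjoint (j : ℕ) :
      Rel d (FreeAlgebra.ι ℂ (Sum.inl j) * FreeAlgebra.ι ℂ (Sum.inr j)) 1

/-- The parafermion algebra `PF_∞` of degree `d`: the unital complex `*`-algebra generated by
`c_0, c_1, c_2, …` subject to `c_j c_k = q c_k c_j` for `j < k`, `c_j ^ d = 1` and
`c_j^* = c_j⁻¹`. The generators are numbered from `0`. -/
def PF (d : ℕ) : Type := RingQuot (Rel d)

instance (d : ℕ) : Ring (PF d) := inferInstanceAs (Ring (RingQuot (Rel d)))

instance (d : ℕ) : Algebra ℂ (PF d) := inferInstanceAs (Algebra ℂ (RingQuot (Rel d)))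

/-- The quotient map from the free algebra. -/
def mk (d : ℕ) : FreeAlgebra ℂ (ℕ ⊕ ℕ) →ₐ[ℂ] PF d := RingQuot.mkAlgHom ℂ (Rel d)

/-- The parafermion generator `c_j`. -/
def c (d j : ℕ) : PF d := mk d (FreeAlgebra.ι ℂ (Sum.inl j))

/-- The adjoint (inverse) of the generator `c_j`. -/
def cStar (d j : ℕ) : PF d := mk d (FreeAlgebra.ι ℂ (Sum.inr j))

lemma mk_rel (d : ℕ) {x y : FreeAlgebra ℂ (ℕ ⊕ ℕ)} (h : Rel d x y) : mk d x = mk d y :=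
  RingQuot.mkAlgHom_rel ℂ h

lemma c_mul_c (d : ℕ) {j k : ℕ} (h : j < k) : c d j * c d k = q d • (c d k * c d j) := by
  simpa only [c, map_mul, map_smul] using mk_rel d (Rel.comm j k h)

lemma c_pow (d j : ℕ) : c d j ^ d = 1 := by
  simpa only [c, map_pow, map_one] using mk_rel d (Rel.pow j)

lemma cStar_mul_c (d j : ℕ) : cStar d j * c d j = 1 := by
  simpa only [c, cStar, map_mul, map_one] using mk_rel d (Rel.adjoint_mul j)

lemma c_mul_cStar (d j : ℕ) : c d j * cStar d j = 1 := by
  simpa only [c, cStar, map_mul, map_one] using mk_rel d (Rel.mul_adjoint j)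

lemma cStar_pow (d j : ℕ) : cStar d j ^ d = 1 := by
  have h : Commute (cStar d j) (c d j) := by
    rw [Commute, SemiconjBy, cStar_mul_c, c_mul_cStar]
  have := h.mul_pow d
  rw [cStar_mul_c, one_pow, c_pow, mul_one] at this
  exact this.symm

lemma cStar_mul_cStar (d : ℕ) {j k : ℕ} (h : j < k) :
    cStar d k * cStar d j = (q d)⁻¹ • (cStar d j * cStar d k) := by
  have h1 : cStar d j * cStar d k * (c d k * c d j) = 1 := by
    rw [mul_assoc, ← mul_assoc (cStar d k), cStar_mul_c, one_mul, cStar_mul_c]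
  have h2 : (c d j * c d k) * (cStar d k * cStar d j) = 1 := by
    rw [mul_assoc, ← mul_assoc (c d k), c_mul_cStar, one_mul, c_mul_cStar]
  rw [c_mul_c d h, smul_mul_assoc] at h2
  calc cStar d k * cStar d j
      = (cStar d j * cStar d k * (c d k * c d j)) * (cStar d k * cStar d j) := by
        rw [h1, one_mul]
    _ = (cStar d j * cStar d k) * ((c d k * c d j) * (cStar d k * cStar d j)) := mul_assoc _ _ _
    _ = (cStar d j * cStar d k) *
          ((q d)⁻¹ • (q d • ((c d k * c d j) * (cStar d k * cStar d j)))) := by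
        rw [smul_smul, inv_mul_cancel₀ (q_ne_zero d), one_smul]
    _ = (q d)⁻¹ • (cStar d j * cStar d k) := by rw [h2, mul_smul_comm, mul_one]

@[ext]
lemma algHom_ext {d : ℕ} {A : Type*} [Semiring A] [Algebra ℂ A] {f g : PF d →ₐ[ℂ] A}
    (h : ∀ j, f (c d j) = g (c d j)) (h' : ∀ j, f (cStar d j) = g (cStar d j)) : f = g := by
  apply RingQuot.ringQuot_ext' (S := ℂ) (s := Rel d)
  apply FreeAlgebra.hom_ext
  funext x
  rcases x with j | j
  · exact h j
  · exact h' j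

/-- The opposite algebra of `PF_∞`, with scalars acting through complex conjugation.
The adjoint is an algebra homomorphism into it. -/
def ConjOp (d : ℕ) : Type := (PF d)ᵐᵒᵖ

instance (d : ℕ) : Ring (ConjOp d) := inferInstanceAs (Ring (PF d)ᵐᵒᵖ)

instance (d : ℕ) : Algebra ℂ (ConjOp d) :=
  RingHom.toAlgebra' ((algebraMap ℂ (PF d)ᵐᵒᵖ).comp (starRingEnd ℂ))
    (fun z x => Algebra.commutes (A := (PF d)ᵐᵒᵖ) (starRingEnd ℂ z) x)

lemma ConjOp.smul_def (d : ℕ) (z : ℂ) (x : ConjOp d) :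
    z • x = (MulOpposite.op (star z • MulOpposite.unop x) : (PF d)ᵐᵒᵖ) := by
  rw [Algebra.smul_def (A := ConjOp d)]
  exact (Algebra.smul_def (A := (PF d)ᵐᵒᵖ) (starRingEnd ℂ z) x).symm

/-- The adjoint, as a homomorphism of complex algebras. -/
def adjointHom (d : ℕ) : PF d →ₐ[ℂ] ConjOp d :=
  RingQuot.liftAlgHom ℂ (s := Rel d)
    ⟨FreeAlgebra.lift ℂ (Sum.elim (fun j => (MulOpposite.op (cStar d j) : (PF d)ᵐᵒᵖ))
        (fun j => (MulOpposite.op (c d j) : (PF d)ᵐᵒᵖ)) : ℕ ⊕ ℕ → ConjOp d), by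
      intro x y h
      cases h with
      | comm j k h =>
        simp only [map_mul, map_smul, FreeAlgebra.lift_ι_apply, ConjOp.smul_def,
          star_q]
        exact congrArg MulOpposite.op (cStar_mul_cStar d h)
      | pow j =>
        simp only [map_pow, map_one, FreeAlgebra.lift_ι_apply]
        exact congrArg MulOpposite.op (cStar_pow d j)
      | adjoint_mul j =>
        simp only [map_mul, map_one, FreeAlgebra.lift_ι_apply]
        exact congrArg MulOpposite.op (cStar_mul_c d j)
      | mul_adjoint j =>
        simp only [map_mul, map_one, FreeAlgebra.lift_ι_apply]
        exact congrArg MulOpposite.op (c_mul_cStar d j)⟩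

instance (d : ℕ) : Star (PF d) := ⟨fun x => MulOpposite.unop (adjointHom d x : (PF d)ᵐᵒᵖ)⟩

lemma star_def (d : ℕ) (x : PF d) :
    star x = MulOpposite.unop (adjointHom d x : (PF d)ᵐᵒᵖ) := rfl

lemma adjointHom_mk_ι (d : ℕ) (x : ℕ ⊕ ℕ) :
    adjointHom d (mk d (FreeAlgebra.ι ℂ x)) =
      (Sum.elim (fun j => (MulOpposite.op (cStar d j) : (PF d)ᵐᵒᵖ))
        (fun j => (MulOpposite.op (c d j) : (PF d)ᵐᵒᵖ)) : ℕ ⊕ ℕ → ConjOp d) x := by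
  unfold adjointHom mk
  erw [RingQuot.liftAlgHom_mkAlgHom_apply]
  rw [FreeAlgebra.lift_ι_apply]

lemma star_c (d j : ℕ) : star (c d j) = cStar d j :=
  congrArg MulOpposite.unop (adjointHom_mk_ι d (Sum.inl j))

lemma star_cStar (d j : ℕ) : star (cStar d j) = c d j :=
  congrArg MulOpposite.unop (adjointHom_mk_ι d (Sum.inr j))

lemma star_mul' (d : ℕ) (x y : PF d) : star (x * y) = star y * star x := by
  simp only [star_def, map_mul]
  rfl

lemma star_add' (d : ℕ) (x y : PF d) : star (x + y) = star x + star y := by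
  simp only [star_def, map_add]
  rfl

lemma star_smul' (d : ℕ) (z : ℂ) (x : PF d) : star (z • x) = star z • star x := by
  simp only [star_def, map_smul, ConjOp.smul_def]
  rfl

lemma star_one' (d : ℕ) : star (1 : PF d) = 1 := by
  simp only [star_def, map_one]
  rfl

/-- Applying the adjoint twice, as a homomorphism of complex algebras. -/
def adjointTwice (d : ℕ) : PF d →ₐ[ℂ] PF d :=
  AlgHom.ofLinearMap
    { toFun := fun x => star (star x)
      map_add' := fun x y => by rw [star_add', star_add']
      map_smul' := fun z x => by rw [star_smul', star_smul', star_star, RingHom.id_apply] }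
    (by change star (star (1 : PF d)) = 1; rw [star_one', star_one'])
    (fun x y => by
      change star (star (x * y)) = star (star x) * star (star y)
      rw [star_mul', star_mul'])

lemma adjointTwice_eq (d : ℕ) : adjointTwice d = AlgHom.id ℂ (PF d) := by
  apply algHom_ext
  · intro j
    change star (star (c d j)) = c d j
    rw [star_c, star_cStar]
  · intro j
    change star (star (cStar d j)) = cStar d j
    rw [star_cStar, star_c]

instance (d : ℕ) : StarRing (PF d) where
  star_involutive x := DFunLike.congr_fun (adjointTwice_eq d) x
  star_mul := star_mul' d
  star_add := star_add' d

instance (d : ℕ) : StarModule ℂ (PF d) := ⟨star_smul' d⟩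

/-- The elements of charge (degree) `k ∈ ℤ/d`: the linear span of the monomials
`c_{i_1} c_{i_2} ⋯ c_{i_r}` with `r ≡ k` modulo `d`. -/
def chargePart (d : ℕ) (k : ZMod d) : Submodule ℂ (PF d) :=
  Submodule.span ℂ {x | ∃ l : List ℕ, (l.length : ZMod d) = k ∧ x = (l.map (c d)).prod}

/-- The normalized Gauss sum `ω = d^{-1/2} ∑_{j=0}^{d-1} ζ^{j²}`. -/
def omega (d : ℕ) (ζ : ℂ) : ℂ := ((Real.sqrt d : ℝ) : ℂ)⁻¹ * ∑ j ∈ Finset.range d, ζ ^ (j ^ 2)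

/-- The two-string braid `(s / √d) ∑_{i=0}^{d-1} c_{k+1}^{-i} c_k^i`, exchanging the strings
`k` and `k + 1`; here `s` is a square root of `ω`, and `c_{k+1}^{-i} = (c_{k+1}^*)^i`.
With this order of the factors `Ad` of the braid sends `c_k` to `c_{k+1}`. -/
def twoStringBraid (d : ℕ) (s : ℂ) (k : ℕ) : PF d :=
  (s * ((Real.sqrt d : ℝ) : ℂ)⁻¹) • ∑ i ∈ Finset.range d, star (c d (k + 1)) ^ i * c d k ^ i

/-- The four-string braid `b_j`, exchanging the `j`-th pair of strings `(2j, 2j+1)` with the next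
pair `(2j+2, 2j+3)` (strings and pairs are numbered from `0`). Its adjoint action sends
`c_{2j}^m c_{2j+1}^n` to `c_{2j+2}^m c_{2j+3}^n`. -/
def fourStringBraid (d : ℕ) (s : ℂ) (j : ℕ) : PF d :=
  twoStringBraid d s (2 * j + 1) * (twoStringBraid d s (2 * j) * twoStringBraid d s (2 * j + 2)) *
    twoStringBraid d s (2 * j + 1)

/-- The four-string braid group `𝔹_∞`, generated by the invertible elements `b_0, b_1, …`. -/
def braidGroup (d : ℕ) (s : ℂ) : Subgroup (PF d)ˣ :=
  Subgroup.closure {u | ∃ j : ℕ, (u : PF d) = fourStringBraid d s j}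

/-- States on `PF_∞`: normalized positive linear functionals. -/
structure IsState {d : ℕ} (φ : PF d →ₗ[ℂ] ℂ) : Prop where
  map_one : φ 1 = 1
  nonneg : ∀ x : PF d, 0 ≤ φ (star x * x)

/-- Braid invariance: `φ = φ ∘ Ad(b)` for every `b ∈ 𝔹_∞`, where `Ad(b)(x) = b x b⁻¹`. -/
def IsBraidInvariant {d : ℕ} (s : ℂ) (φ : PF d →ₗ[ℂ] ℂ) : Prop :=
  ∀ b ∈ braidGroup d s, ∀ x : PF d, φ ((b : PF d) * x * ((b⁻¹ : (PF d)ˣ) : PF d)) = φ x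

/-- Neutrality: `φ` vanishes on all elements of nonzero charge. -/
def IsNeutral {d : ℕ} (φ : PF d →ₗ[ℂ] ℂ) : Prop :=
  ∀ k : ZMod d, k ≠ 0 → ∀ x ∈ chargePart d k, φ x = 0

end Parafermion

end

/-! Braid invariance makes `φ` spreadable. A long product `b_k b_{k+1} ⋯` moves every pair from `k`
up to any chosen bound one place to the right, so `φ` is unchanged when empty pairs are inserted
anywhere (`IsBraidInvariant.reindex_gap`).

Let `x` be a monomial of length `L` with `d ∤ L`, and let `X i` be its translates to disjoint
successive blocks. In the GNS semi-inner product, `⟪X i, X j⟫ = a` for all `i < j`. Cauchy–Schwarz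
for sums over long blocks forces `a ≥ 0` (`norm_le_re_of_spreadable`). The same argument for the
adjoints gives `r⁻¹ * star a ≥ 0`, where `r = q ^ (L * L)` is the phase from exchanging two blocks.
Since `d` is square-free, `d ∤ L²` and `r ≠ 1`, so `a = 0`. Testing averages of the `X i` against
`1` yields `|φ x|² ≤ a.re = 0` (`norm_sq_le_re_of_spreadable`). -/

open scoped InnerProductSpace

namespace Parafermion

/-! ### Root-of-unity sums and the Gauss sum. -/

section Sums

lemma sum_range_add_of_periodic {M : Type*} [AddCommGroup M] {d : ℕ} {f : ℕ → M}
    (hf : ∀ i, f (i + d) = f i) (j : ℕ) :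
    ∑ i ∈ Finset.range d, f (i + j) = ∑ i ∈ Finset.range d, f i := by
  induction j with
  | zero => simp
  | succ j ih =>
    rw [← ih]
    have h1 := Finset.sum_range_succ (fun i => f (i + j)) d
    have h2 := Finset.sum_range_succ' (fun i => f (i + j)) d
    have h3 : f (d + j) = f (0 + j) := by rw [add_comm, hf, zero_add]
    rw [h1, h3] at h2
    have := add_right_cancel h2
    rw [this]
    exact Finset.sum_congr rfl fun i _ => by congr 1; ring

lemma sum_sum_root_pow_smul {M : Type*} [AddCommGroup M] [Module ℂ M] {d : ℕ} (hd : d ≠ 0)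
    {r : ℂ} (hr : IsPrimitiveRoot r d) (f : ℕ → M) :
    ∑ j ∈ Finset.range d, ∑ m ∈ Finset.range d, r ^ (m * j) • f m = (d : ℂ) • f 0 := by
  rw [Finset.sum_comm, Finset.sum_eq_single_of_mem 0 (by simpa using Nat.pos_of_ne_zero hd)]
  · simp [Nat.cast_smul_eq_nsmul]
  · intro m hm hm0
    rw [← Finset.sum_smul]
    have h1 : r ^ m ≠ 1 := hr.pow_ne_one_of_pos_of_lt hm0 (Finset.mem_range.1 hm)
    have h2 := mul_geom_sum (r ^ m) d
    rw [← pow_mul, mul_comm m d, pow_mul, hr.pow_eq_one, one_pow, sub_self, mul_eq_zero] at h2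
    have h3 := h2.resolve_left (sub_ne_zero.2 h1)
    simp only [← pow_mul] at h3
    rw [h3, zero_smul]

/-- The Gauss sum times the sum of the inverse terms is `d`. The condition `ζ ^ (d ^ 2) = 1` makes
`ζ ^ (i ^ 2)` periodic modulo `d`, which permits the shift `i = m + j`; orthogonality of characters
then leaves only `m = 0`. This gives `s ≠ 0`, hence invertible braids. -/
lemma gauss_sum_ne_zero {d : ℕ} (hd : d ≠ 0) {ζ : ℂ} (hζ : IsPrimitiveRoot (ζ ^ 2) d)
    (hζd : ζ ^ (d ^ 2) = 1) : ∑ j ∈ Finset.range d, ζ ^ (j ^ 2) ≠ 0 := by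
  have hζ0 : ζ ≠ 0 := by
    rintro rfl
    rw [zero_pow (pow_ne_zero 2 hd)] at hζd
    exact zero_ne_one hζd
  have hper : ∀ i, ζ ^ ((i + d) ^ 2) = ζ ^ (i ^ 2) := by
    intro i
    rw [show (i + d) ^ 2 = i ^ 2 + 2 * d * i + d ^ 2 by ring, pow_add, pow_add, hζd,
      pow_mul, pow_mul, hζ.pow_eq_one]
    simp
  have key : (∑ i ∈ Finset.range d, ζ ^ (i ^ 2)) * ∑ j ∈ Finset.range d, (ζ ^ (j ^ 2))⁻¹ = d := by
    have h := sum_sum_root_pow_smul hd hζ (fun m => ζ ^ (m ^ 2))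
    rw [Finset.mul_sum]
    simp only [smul_eq_mul] at h
    rw [show (d : ℂ) = d * ζ ^ (0 ^ 2) by simp, ← h]
    refine Finset.sum_congr rfl fun j _ => ?_
    rw [← sum_range_add_of_periodic (f := fun i => ζ ^ (i ^ 2)) hper j, Finset.sum_mul]
    refine Finset.sum_congr rfl fun m _ => ?_
    rw [mul_inv_eq_iff_eq_mul₀ (pow_ne_zero _ hζ0)]
    ring
  intro h0
  rw [h0, zero_mul] at key
  exact hd (by exact_mod_cast key.symm)

end Sums

/-! ### Sums of Weyl-type products in a `q`-commuting pair. -/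

section Weyl

variable {A : Type*} [Ring A] [Algebra ℂ A]

lemma pow_mul_pow_of_qcomm {x y : A} {r : ℂ} (h : x * y = r • (y * x)) (i j : ℕ) :
    x ^ i * y ^ j = r ^ (j * i) • (y ^ j * x ^ i) := by
  have h1 : ∀ i, x ^ i * y = r ^ i • (y * x ^ i) := by
    intro i
    induction i with
    | zero => simp
    | succ i ih =>
      rw [pow_succ, mul_assoc, h, mul_smul_comm, ← mul_assoc, ih, smul_mul_assoc, smul_smul,
        ← pow_succ', mul_assoc]
  induction j with
  | zero => simp
  | succ j ih =>
    rw [pow_succ, ← mul_assoc, ih, smul_mul_assoc, mul_assoc, h1, mul_smul_comm, smul_smul,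
      ← mul_assoc, add_mul, one_mul, pow_add]

/-- Noncommutative form of the Gauss sum computation: after the shift `i = m + j`, moving `v ^ j`
past `c ^ m` leaves the phase `r ^ (m * j)`, and summing over `j` kills every `m ≠ 0`. -/
lemma weyl_sum_mul_weyl_sum_inv {d : ℕ} (hd : d ≠ 0) {r : ℂ} (hr : IsPrimitiveRoot r d)
    {v v' c c' : A} (hv : v ^ d = 1) (hc : c ^ d = 1) (hv' : v * v' = 1) (hv'' : v' * v = 1)
    (hc' : c * c' = 1) (hc'' : c' * c = 1) (h : v * c = r • (c * v)) :
    (∑ i ∈ Finset.range d, v ^ i * c ^ i) * ∑ j ∈ Finset.range d, c' ^ j * v' ^ j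
      = (d : ℂ) • (1 : A) := by
  have hvc : ∀ j, v ^ j * v' ^ j = 1 := fun j => by
    rw [← (show Commute v v' by rw [Commute, SemiconjBy, hv', hv'']).mul_pow, hv', one_pow]
  have hcc : ∀ j, c ^ j * c' ^ j = 1 := fun j => by
    rw [← (show Commute c c' by rw [Commute, SemiconjBy, hc', hc'']).mul_pow, hc', one_pow]
  have hS := sum_sum_root_pow_smul hd hr (fun m => v ^ m * c ^ m)
  rw [show (1 : A) = v ^ 0 * c ^ 0 by simp, ← hS, Finset.mul_sum]
  refine Finset.sum_congr rfl fun j _ => ?_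
  rw [← sum_range_add_of_periodic (f := fun i => v ^ i * c ^ i)
    (fun i => by simp [pow_add, hv, hc]) j, Finset.sum_mul]
  refine Finset.sum_congr rfl fun m _ => ?_
  calc v ^ (m + j) * c ^ (m + j) * (c' ^ j * v' ^ j)
      = v ^ m * (v ^ j * c ^ m) * (c ^ j * c' ^ j) * v' ^ j := by
        rw [pow_add, pow_add]; simp only [mul_assoc]
    _ = r ^ (m * j) • (v ^ m * c ^ m * (v ^ j * v' ^ j)) := by
        rw [hcc, mul_one, pow_mul_pow_of_qcomm h, mul_smul_comm, smul_mul_assoc]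
        simp only [mul_assoc]
    _ = r ^ (m * j) • (v ^ m * c ^ m) := by rw [hvc, mul_one]

end Weyl

/-! ### Invertibility of the braids and their action on generators. -/

section Braids

lemma cStar_mul_c_of_lt (d : ℕ) {j k : ℕ} (h : j < k) :
    cStar d k * c d j = q d • (c d j * cStar d k) := by
  have h1 := congrArg (fun x => cStar d k * x * cStar d k) (c_mul_c d h)
  simp only [mul_smul_comm, smul_mul_assoc] at h1
  rw [mul_assoc, mul_assoc, c_mul_cStar, mul_one, ← mul_assoc (cStar d k) (c d k),
    cStar_mul_c, one_mul] at h1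
  exact h1

lemma c_mul_cStar_of_lt (d : ℕ) {j k : ℕ} (h : j < k) :
    c d k * cStar d j = q d • (cStar d j * c d k) := by
  have h1 := congrArg (fun x => cStar d j * x * cStar d j) (c_mul_c d h)
  simp only [mul_smul_comm, smul_mul_assoc] at h1
  rw [← mul_assoc, cStar_mul_c, one_mul, mul_assoc, mul_assoc (c d k), c_mul_cStar, mul_one] at h1
  exact h1

lemma q_isPrimitiveRoot {d : ℕ} (hd : d ≠ 0) : IsPrimitiveRoot (q d) d :=
  Complex.isPrimitiveRoot_exp d hd

lemma isUnit_twoStringBraid {d : ℕ} (hd : d ≠ 0) {s : ℂ} (hs : s ≠ 0) (k : ℕ) :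
    IsUnit (twoStringBraid d s k) := by
  have hd' : (d : ℂ) ≠ 0 := Nat.cast_ne_zero.2 hd
  have hk : s * ((Real.sqrt d : ℝ) : ℂ)⁻¹ ≠ 0 :=
    mul_ne_zero hs (inv_ne_zero (Complex.ofReal_ne_zero.2
      (Real.sqrt_ne_zero'.2 (by exact_mod_cast Nat.pos_of_ne_zero hd))))
  have hkk := Nat.lt_succ_self k
  have h1 := weyl_sum_mul_weyl_sum_inv hd (q_isPrimitiveRoot hd) (cStar_pow d (k + 1)) (c_pow d k)
    (cStar_mul_c d (k + 1)) (c_mul_cStar d (k + 1)) (c_mul_cStar d k) (cStar_mul_c d k)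
    (cStar_mul_c_of_lt d hkk)
  -- Exchanging the two generators replaces `q` by `q⁻¹` and gives the same two sums in the opposite
  -- order, so the inverse is two-sided.
  have h2 := weyl_sum_mul_weyl_sum_inv hd (q_isPrimitiveRoot hd).inv (cStar_pow d k)
    (c_pow d (k + 1)) (cStar_mul_c d k) (c_mul_cStar d k) (c_mul_cStar d (k + 1))
    (cStar_mul_c d (k + 1)) (r := (q d)⁻¹) (by
      rw [c_mul_cStar_of_lt d hkk, smul_smul, inv_mul_cancel₀ (q_ne_zero d), one_smul])
  have hU : IsUnit (∑ i ∈ Finset.range d, cStar d (k + 1) ^ i * c d k ^ i) := by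
    refine ⟨⟨∑ i ∈ Finset.range d, cStar d (k + 1) ^ i * c d k ^ i, (d : ℂ)⁻¹ • ∑ j ∈ Finset.range d, cStar d k ^ j * c d (k + 1) ^ j, ?_, ?_⟩, rfl⟩
    · rw [mul_smul_comm, h1, smul_smul, inv_mul_cancel₀ hd', one_smul]
    · rw [smul_mul_assoc, h2, smul_smul, inv_mul_cancel₀ hd', one_smul]
  simp only [twoStringBraid, star_c]
  exact hU.smul (Units.mk0 _ hk)

/-- Left multiplication by `c_{k+1}` cancels one adjoint, leaving an extra `c_k` on the right; this
is a cyclic shift of the summation index. -/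
lemma twoStringBraid_mul_c (d : ℕ) (s : ℂ) (k : ℕ) :
    twoStringBraid d s k * c d k = c d (k + 1) * twoStringBraid d s k := by
  simp only [twoStringBraid, star_c, smul_mul_assoc, mul_smul_comm]
  congr 1
  have := sum_range_add_of_periodic
    (f := fun i => c d (k + 1) * (cStar d (k + 1) ^ i * c d k ^ i))
    (d := d) (fun i => by simp [pow_add, cStar_pow, c_pow]) 1
  rw [Finset.mul_sum, ← this, Finset.sum_mul]
  refine Finset.sum_congr rfl fun i _ => ?_
  rw [pow_succ', ← mul_assoc, ← mul_assoc, c_mul_cStar, one_mul, pow_succ, mul_assoc]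

lemma commute_pow_mul_pow_of_qcomm {A : Type*} [Ring A] [Algebra ℂ A] {x v c : A} {r : ℂ}
    (hr : r ≠ 0) (hv : x * v = r⁻¹ • (v * x)) (hc : x * c = r • (c * x)) (i : ℕ) :
    Commute x (v ^ i * c ^ i) := by
  have h1 := pow_mul_pow_of_qcomm hv 1 i
  have h2 := pow_mul_pow_of_qcomm hc 1 i
  rw [pow_one, mul_one] at h1 h2
  rw [Commute, SemiconjBy, ← mul_assoc, h1, smul_mul_assoc, mul_assoc, h2, mul_smul_comm,
    smul_smul, ← mul_pow, inv_mul_cancel₀ hr, one_pow, one_smul, mul_assoc]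

/-- A generator off the two strings picks up inverse phases from the two factors of each term. -/
lemma twoStringBraid_commute_c (d : ℕ) (s : ℂ) {k m : ℕ} (h0 : m ≠ k) (h1 : m ≠ k + 1) :
    Commute (c d m) (twoStringBraid d s k) := by
  have hq := q_ne_zero d
  simp only [twoStringBraid, star_c]
  refine (Commute.sum_right _ _ _ fun i _ => ?_).smul_right _
  rcases lt_or_gt_of_ne h0 with h | h
  · refine commute_pow_mul_pow_of_qcomm hq ?_ (c_mul_c d h) i
    rw [cStar_mul_c_of_lt d (show m < k + 1 by omega), smul_smul, inv_mul_cancel₀ hq, one_smul]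
  · refine commute_pow_mul_pow_of_qcomm (inv_ne_zero hq) ?_ ?_ i
    · rw [inv_inv, c_mul_cStar_of_lt d (show k + 1 < m by omega)]
    · rw [c_mul_c d h, smul_smul, inv_mul_cancel₀ hq, one_smul]

lemma isUnit_fourStringBraid {d : ℕ} (hd : d ≠ 0) {s : ℂ} (hs : s ≠ 0) (j : ℕ) :
    IsUnit (fourStringBraid d s j) :=
  ((isUnit_twoStringBraid hd hs _).mul
    ((isUnit_twoStringBraid hd hs _).mul (isUnit_twoStringBraid hd hs _))).mul
    (isUnit_twoStringBraid hd hs _)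

lemma fourStringBraid_commute_c (d : ℕ) (s : ℂ) {j m : ℕ} (h : m < 2 * j ∨ 2 * j + 3 < m) :
    Commute (c d m) (fourStringBraid d s j) := by
  refine ((twoStringBraid_commute_c d s ?_ ?_).mul_right
    ((twoStringBraid_commute_c d s ?_ ?_).mul_right
      (twoStringBraid_commute_c d s ?_ ?_))).mul_right (twoStringBraid_commute_c d s ?_ ?_) <;>
  omega

/-- The paths are `2j → 2j+1 → 2j+2` and `2j+1 → 2j+2 → 2j+3`. Only the lower pair is followed; the
image of the upper pair is never needed. -/
lemma fourStringBraid_semiconj_c (d : ℕ) (s : ℂ) {j m : ℕ} (h : m = 2 * j ∨ m = 2 * j + 1) :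
    SemiconjBy (fourStringBraid d s j) (c d m) (c d (m + 2)) := by
  have hstep : ∀ k, SemiconjBy (twoStringBraid d s k) (c d k) (c d (k + 1)) :=
    twoStringBraid_mul_c d s
  have hfix : ∀ {k m : ℕ}, m ≠ k → m ≠ k + 1 → SemiconjBy (twoStringBraid d s k) (c d m) (c d m) :=
    fun h0 h1 => (twoStringBraid_commute_c d s h0 h1).symm
  rcases h with rfl | rfl
  · refine (SemiconjBy.mul_left (y := c d (2 * j + 1)) (hstep _) ?_).mul_left
      (hfix (by omega) (by omega))
    exact (hstep _).mul_left (hfix (by omega) (by omega))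
  · refine (SemiconjBy.mul_left (y := c d (2 * j + 3)) (hfix (by omega) (by omega)) ?_).mul_left
      (hstep _)
    exact (hfix (by omega) (by omega)).mul_left (hstep _)

end Braids

/-! ### Relabelling endomorphisms, locally implemented by braids. -/

section Reindexing

/-- The endomorphism of `PF_∞` relabelling the generators along a strictly increasing map. -/
noncomputable def reindex (d : ℕ) (g : ℕ → ℕ) (hg : StrictMono g) : PF d →ₐ[ℂ] PF d :=
  RingQuot.liftAlgHom ℂ (s := Rel d)
    ⟨FreeAlgebra.lift ℂ (Sum.elim (fun j => c d (g j)) (fun j => cStar d (g j))), by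
      intro x y h
      cases h with
      | comm j k h =>
        simp only [map_mul, map_smul, FreeAlgebra.lift_ι_apply]
        exact c_mul_c d (hg h)
      | pow j =>
        simp only [map_pow, map_one, FreeAlgebra.lift_ι_apply]
        exact c_pow d (g j)
      | adjoint_mul j =>
        simp only [map_mul, map_one, FreeAlgebra.lift_ι_apply]
        exact cStar_mul_c d (g j)
      | mul_adjoint j =>
        simp only [map_mul, map_one, FreeAlgebra.lift_ι_apply]
        exact c_mul_cStar d (g j)⟩

variable {d : ℕ} {g : ℕ → ℕ} (hg : StrictMono g)

lemma reindex_mk_ι (x : ℕ ⊕ ℕ) :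
    reindex d g hg (mk d (FreeAlgebra.ι ℂ x)) =
      Sum.elim (fun j => c d (g j)) (fun j => cStar d (g j)) x := by
  unfold reindex mk
  erw [RingQuot.liftAlgHom_mkAlgHom_apply]
  rw [FreeAlgebra.lift_ι_apply]

lemma reindex_c (j : ℕ) : reindex d g hg (c d j) = c d (g j) := reindex_mk_ι hg (Sum.inl j)

lemma reindex_cStar (j : ℕ) : reindex d g hg (cStar d j) = cStar d (g j) :=
  reindex_mk_ι hg (Sum.inr j)

lemma induction_on {P : PF d → Prop} (x : PF d) (hc : ∀ j, P (c d j)) (hc' : ∀ j, P (cStar d j))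
    (halg : ∀ z : ℂ, P (algebraMap ℂ (PF d) z)) (hadd : ∀ x y, P x → P y → P (x + y))
    (hmul : ∀ x y, P x → P y → P (x * y)) : P x := by
  obtain ⟨a, rfl⟩ : ∃ a, mk d a = x := RingQuot.mkAlgHom_surjective ℂ (Rel d) x
  induction a using FreeAlgebra.induction with
  | grade0 z => simpa using halg z
  | grade1 x => cases x with
    | inl j => exact hc j
    | inr j => exact hc' j
  | mul a b ha hb => simpa using hmul _ _ ha hb
  | add a b ha hb => simpa using hadd _ _ ha hb

lemma reindex_star (x : PF d) : reindex d g hg (star x) = star (reindex d g hg x) := by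
  induction x using induction_on with
  | hc j => rw [star_c, reindex_c, reindex_cStar, star_c]
  | hc' j => rw [star_cStar, reindex_c, reindex_cStar, star_cStar]
  | halg z => simp [Algebra.algebraMap_eq_smul_one]
  | hadd x y hx hy => simp [hx, hy]
  | hmul x y hx hy => simp [hx, hy]

/-- Insert `m` new pairs of strings before the pair numbered `k`. -/
def gap (k m i : ℕ) : ℕ := if i < 2 * k then i else i + 2 * m

lemma gap_strictMono (k m : ℕ) : StrictMono (gap k m) := by
  intro a b h
  unfold gap
  split_ifs <;> omega

/-- The product `b_k b_{k+1} ⋯ b_{k+n-1}`. -/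
noncomputable def braidRun (d : ℕ) (s : ℂ) (k n : ℕ) : PF d :=
  ((List.range n).map fun p => fourStringBraid d s (k + p)).prod

lemma braidRun_succ (d : ℕ) (s : ℂ) (k n : ℕ) :
    braidRun d s k (n + 1) = braidRun d s k n * fourStringBraid d s (k + n) := by
  simp [braidRun, List.range_succ]

lemma braidRun_commute_c (d : ℕ) (s : ℂ) {k n m : ℕ} (h : m < 2 * k ∨ 2 * (k + n) + 1 < m) :
    SemiconjBy (braidRun d s k n) (c d m) (c d m) := by
  induction n with
  | zero => simp [braidRun]
  | succ n ih =>
    rw [braidRun_succ]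
    exact (ih (by omega)).mul_left (fourStringBraid_commute_c d s (by omega)).symm

/-- The rightmost factor acts first. A generator in pair `p` with `k ≤ p < k + n` is fixed by the
factors after `b_p`, moved to pair `p + 1` by `b_p`, and is then out of reach of the earlier
factors. -/
lemma braidRun_semiconj_c (d : ℕ) (s : ℂ) {k n m : ℕ} (h : m < 2 * (k + n)) :
    SemiconjBy (braidRun d s k n) (c d m) (c d (gap k 1 m)) := by
  induction n with
  | zero =>
    rw [gap, if_pos (by omega)]
    simp [braidRun]
  | succ n ih =>
    rw [braidRun_succ]
    by_cases hm : m < 2 * (k + n)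
    · exact (ih hm).mul_left (fourStringBraid_commute_c d s (by omega)).symm
    · rw [gap, if_neg (by omega)]
      exact (braidRun_commute_c d s (by omega)).mul_left
        (fourStringBraid_semiconj_c d s (by omega))

lemma semiconjBy_cStar {b : PF d} {j k : ℕ} (h : SemiconjBy b (c d j) (c d k)) :
    SemiconjBy b (cStar d j) (cStar d k) := by
  have h1 := congrArg (fun x => cStar d k * x * cStar d j) h.eq
  rw [mul_assoc, mul_assoc b, c_mul_cStar, mul_one, ← mul_assoc, cStar_mul_c, one_mul] at h1
  exact h1.symm

open Filter in
-- An element involves finitely many generators, so a sufficiently long run acts on it as the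
-- insertion of one pair.
lemma eventually_braidRun_semiconj (s : ℂ) (k : ℕ) (x : PF d) :
    ∀ᶠ n in atTop, SemiconjBy (braidRun d s k n) x (reindex d _ (gap_strictMono k 1) x) := by
  induction x using induction_on with
  | hc j =>
    filter_upwards [eventually_ge_atTop (j + 1)] with n hn
    rw [reindex_c]
    exact braidRun_semiconj_c d s (by omega)
  | hc' j =>
    filter_upwards [eventually_ge_atTop (j + 1)] with n hn
    rw [reindex_cStar]
    exact semiconjBy_cStar (braidRun_semiconj_c d s (by omega))
  | halg z =>
    refine Eventually.of_forall fun n => ?_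
    rw [AlgHom.commutes]
    exact (Algebra.commutes z _).symm
  | hadd x y hx hy =>
    filter_upwards [hx, hy] with n h1 h2
    rw [map_add]
    exact h1.add_right h2
  | hmul x y hx hy =>
    filter_upwards [hx, hy] with n h1 h2
    rw [map_mul]
    exact h1.mul_right h2

end Reindexing

/-! ### Spreadability of braid-invariant functionals. -/

section Invariance

variable {d : ℕ} {s : ℂ} {φ : PF d →ₗ[ℂ] ℂ}

lemma exists_braidGroup_eq_braidRun (hd : d ≠ 0) (hs : s ≠ 0) (k n : ℕ) :
    ∃ b ∈ braidGroup d s, (b : PF d) = braidRun d s k n := by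
  induction n with
  | zero => exact ⟨1, one_mem _, by simp [braidRun]⟩
  | succ n ih =>
    obtain ⟨b, hb, hbn⟩ := ih
    obtain ⟨u, hu⟩ := isUnit_fourStringBraid hd hs (k + n)
    exact ⟨b * u, mul_mem hb (Subgroup.subset_closure ⟨_, hu⟩), by
      rw [Units.val_mul, hbn, hu, braidRun_succ]⟩

lemma IsBraidInvariant.reindex_gap_one (hd : d ≠ 0) (hs : s ≠ 0) (hinv : IsBraidInvariant s φ)
    (k : ℕ) (x : PF d) : φ (reindex d _ (gap_strictMono k 1) x) = φ x := by
  obtain ⟨n, hn⟩ := (eventually_braidRun_semiconj s k x).exists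
  obtain ⟨b, hb, hbn⟩ := exists_braidGroup_eq_braidRun hd hs k n
  rw [← hinv b hb x, hbn, hn.eq, ← hbn, mul_assoc, Units.mul_inv, mul_one]

lemma reindex_gap_succ (k m : ℕ) (x : PF d) :
    reindex d _ (gap_strictMono k (m + 1)) x =
      reindex d _ (gap_strictMono k 1) (reindex d _ (gap_strictMono k m) x) := by
  have h : ∀ j, gap k (m + 1) j = gap k 1 (gap k m j) := by
    intro j
    unfold gap
    split_ifs <;> omega
  induction x using induction_on with
  | hc j => simp only [reindex_c, h]
  | hc' j => simp only [reindex_cStar, h]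
  | halg z => simp only [AlgHom.commutes]
  | hadd x y hx hy => simp only [map_add, hx, hy]
  | hmul x y hx hy => simp only [map_mul, hx, hy]

lemma IsBraidInvariant.reindex_gap (hd : d ≠ 0) (hs : s ≠ 0) (hinv : IsBraidInvariant s φ)
    (k m : ℕ) (x : PF d) : φ (reindex d _ (gap_strictMono k m) x) = φ x := by
  induction m with
  | zero =>
    congr 1
    induction x using induction_on with
    | hc j => simp [reindex_c, gap]
    | hc' j => simp [reindex_cStar, gap]
    | halg z => simp only [AlgHom.commutes]
    | hadd x y hx hy => simp only [map_add, hx, hy]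
    | hmul x y hx hy => simp only [map_mul, hx, hy]
  | succ m ih => rw [reindex_gap_succ, hinv.reindex_gap_one hd hs, ih]

end Invariance

/-! ### Unitarity and exchange phases of monomials. -/

section Monomials

variable {d : ℕ}

/-- The monomial `c_{i_1} ⋯ c_{i_r}`. -/
noncomputable def monomial (d : ℕ) (l : List ℕ) : PF d := (l.map (c d)).prod

lemma monomial_cons (j : ℕ) (l : List ℕ) : monomial d (j :: l) = c d j * monomial d l := by
  simp [monomial]

lemma star_monomial_mul_self (l : List ℕ) : star (monomial d l) * monomial d l = 1 := by
  induction l with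
  | nil => simp [monomial]
  | cons j l ih =>
    rw [monomial_cons, star_mul, star_c, mul_assoc, ← mul_assoc (cStar d j), cStar_mul_c, one_mul,
      ih]

lemma monomial_mul_star_self (l : List ℕ) : monomial d l * star (monomial d l) = 1 := by
  induction l with
  | nil => simp [monomial]
  | cons j l ih =>
    rw [monomial_cons, star_mul, star_c, mul_assoc, ← mul_assoc (monomial d l), ih, one_mul,
      c_mul_cStar]

lemma reindex_monomial {g : ℕ → ℕ} (hg : StrictMono g) (l : List ℕ) :
    reindex d g hg (monomial d l) = monomial d (l.map g) := by
  induction l with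
  | nil => simp [monomial]
  | cons j l ih => rw [List.map_cons, monomial_cons, monomial_cons, map_mul, reindex_c, ih]

lemma c_mul_monomial {j : ℕ} {l : List ℕ} (h : ∀ k ∈ l, j < k) :
    c d j * monomial d l = q d ^ l.length • (monomial d l * c d j) := by
  induction l with
  | nil => simp [monomial]
  | cons k l ih =>
    rw [monomial_cons, ← mul_assoc, c_mul_c d (h k (by simp)), smul_mul_assoc, mul_assoc,
      ih fun k hk => h k (by simp [hk]), mul_smul_comm, smul_smul, List.length_cons, pow_succ',
      mul_assoc]

lemma monomial_mul_monomial {l l' : List ℕ} (h : ∀ j ∈ l, ∀ k ∈ l', j < k) :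
    monomial d l * monomial d l' =
      q d ^ (l.length * l'.length) • (monomial d l' * monomial d l) := by
  induction l with
  | nil => simp [monomial]
  | cons j l ih =>
    rw [monomial_cons, mul_assoc, ih fun j hj => h j (by simp [hj]), mul_smul_comm, ← mul_assoc,
      c_mul_monomial (h j (by simp)), smul_mul_assoc, smul_smul, ← pow_add, mul_assoc,
      List.length_cons, add_mul, one_mul]

end Monomials

/-! ### Spreadable sequences of unit vectors. -/

section InnerProduct

variable {E : Type*} [SeminormedAddCommGroup E] [InnerProductSpace ℂ E]

lemma norm_sum_sq_of_spreadable {ξ : ℕ → E} {a : ℂ} (hξ : ∀ i, ⟪ξ i, ξ i⟫_ℂ = 1)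
    (ha : ∀ i j, i < j → ⟪ξ i, ξ j⟫_ℂ = a) (N : ℕ) :
    ‖∑ i ∈ Finset.range N, ξ i‖ ^ 2 = N + N * (N - 1) * a.re := by
  induction N with
  | zero => simp
  | succ N ih =>
    have h1 : ⟪∑ i ∈ Finset.range N, ξ i, ξ N⟫_ℂ = N * a := by
      rw [sum_inner, Finset.sum_congr rfl fun i hi => ha i N (Finset.mem_range.1 hi)]
      simp
    have h2 : ‖ξ N‖ ^ 2 = 1 := by
      have := inner_self_eq_norm_sq_to_K (𝕜 := ℂ) (ξ N)
      rw [hξ] at this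
      exact Complex.ofReal_injective (by simpa using this.symm)
    rw [Finset.sum_range_succ, norm_add_sq (𝕜 := ℂ), ih, h1, h2]
    simp
    ring

lemma le_of_forall_nat_mul_sq_le {x y : ℝ}
    (h : ∀ N : ℕ, N ^ 2 * x ≤ N + N * (N - 1) * y) : x ≤ y := by
  by_contra! hlt
  -- Dividing by `N ^ 2` and letting `N → ∞` is made explicit: this `N`, used as `N + 1`, violates
  -- the hypothesis.
  obtain ⟨N, hN⟩ := exists_nat_gt ((1 - y) / (x - y))
  rw [div_lt_iff₀ (sub_pos.2 hlt)] at hN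
  have h1 := h (N + 1)
  push_cast at h1
  have h2 : (N + 1 : ℝ) * ((N + 1) * (x - y) - (1 - y)) ≤ 0 := by linarith
  have h3 : 0 < (N + 1 : ℝ) * ((N + 1) * (x - y) - (1 - y)) := by
    apply mul_pos (by positivity)
    linarith
  linarith

/-- Cauchy–Schwarz against `v` gives `N² ‖t‖² ≤ ‖∑ ξ i‖²`, whose leading term is `N² a.re`. -/
lemma norm_sq_le_re_of_spreadable {ξ : ℕ → E} {a t : ℂ} {v : E} (hv : ⟪v, v⟫_ℂ = 1)
    (hξ : ∀ i, ⟪ξ i, ξ i⟫_ℂ = 1) (ha : ∀ i j, i < j → ⟪ξ i, ξ j⟫_ℂ = a)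
    (ht : ∀ i, ⟪v, ξ i⟫_ℂ = t) : ‖t‖ ^ 2 ≤ a.re := by
  refine le_of_forall_nat_mul_sq_le fun N => ?_
  rw [← norm_sum_sq_of_spreadable hξ ha]
  have h1 : ⟪v, ∑ i ∈ Finset.range N, ξ i⟫_ℂ = N * t := by simp [inner_sum, ht]
  have h2 : ‖v‖ ^ 2 = 1 := by
    have := inner_self_eq_norm_sq_to_K (𝕜 := ℂ) v
    rw [hv] at this
    exact Complex.ofReal_injective (by simpa using this.symm)
  have h3 := norm_inner_le_norm (𝕜 := ℂ) v (∑ i ∈ Finset.range N, ξ i)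
  rw [h1, norm_mul, Complex.norm_natCast] at h3
  have h4 := pow_le_pow_left₀ (by positivity) h3 2
  rwa [mul_pow, mul_pow, h2, one_mul] at h4

/-- Pairing two successive blocks of length `N` gives exactly `N² a`, as every index of the first
precedes every index of the second. Each block sum has squared norm `N + N(N-1) a.re`, so
Cauchy–Schwarz shows that `a` is real and nonnegative. -/
lemma norm_le_re_of_spreadable {ξ : ℕ → E} {a : ℂ} (hξ : ∀ i, ⟪ξ i, ξ i⟫_ℂ = 1)
    (ha : ∀ i j, i < j → ⟪ξ i, ξ j⟫_ℂ = a) : ‖a‖ ≤ a.re := by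
  refine le_of_forall_nat_mul_sq_le fun N => ?_
  have h1 := norm_sum_sq_of_spreadable hξ ha N
  have h2 := norm_sum_sq_of_spreadable (ξ := fun i => ξ (N + i)) (fun i => hξ _)
    (fun i j h => ha _ _ (by omega)) N
  have h3 := norm_inner_le_norm (𝕜 := ℂ) (∑ i ∈ Finset.range N, ξ i)
    (∑ i ∈ Finset.range N, ξ (N + i))
  have h4 : ⟪∑ i ∈ Finset.range N, ξ i, ∑ i ∈ Finset.range N, ξ (N + i)⟫_ℂ = N ^ 2 * a := by
    rw [sum_inner, Finset.sum_congr rfl fun i hi => (inner_sum (𝕜 := ℂ) _ _ _).trans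
      (Finset.sum_congr rfl fun j _ => ha i (N + j) (by have := Finset.mem_range.1 hi; omega))]
    simp
    ring
  rw [h4, norm_mul, norm_pow, Complex.norm_natCast] at h3
  nlinarith [sq_nonneg (‖∑ i ∈ Finset.range N, ξ i‖ - ‖∑ i ∈ Finset.range N, ξ (N + i)‖)]

end InnerProduct

/-! ### The GNS form and vanishing on charged monomials. -/

section States

variable {d : ℕ} {φ : PF d →ₗ[ℂ] ℂ}

/-- Polarization: `φ` is real on `y^* y` for `y = x`, `1 + x` and `1 + I • x`. -/
lemma IsState.map_star (hφ : IsState φ) (x : PF d) : φ (star x) = star (φ x) := by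
  have h0 := (Complex.nonneg_iff.1 (hφ.nonneg x)).2
  have h1 := (Complex.nonneg_iff.1 (hφ.nonneg (1 + x))).2
  have h2 := (Complex.nonneg_iff.1 (hφ.nonneg (1 + Complex.I • x))).2
  simp only [star_add, star_one, star_smul, add_mul, mul_add, one_mul, mul_one, map_add, map_smul,
    smul_mul_assoc, mul_smul_comm, hφ.map_one, smul_eq_mul] at h1 h2
  apply Complex.ext
  · simp at h2 h0 ⊢
    linarith
  · simp at h1 h0 ⊢
    linarith

/-- The semi-inner product `⟪x, y⟫ = φ (x^* y)` of the GNS construction. -/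
@[reducible]
noncomputable def IsState.preInnerCore (hφ : IsState φ) : PreInnerProductSpace.Core ℂ (PF d) where
  inner x y := φ (star x * y)
  conj_inner_symm x y := by
    rw [← Complex.star_def, ← hφ.map_star, star_mul, star_star]
  re_inner_nonneg x := (Complex.nonneg_iff.1 (hφ.nonneg x)).1
  add_left x y z := by rw [star_add, add_mul, map_add]
  smul_left x y r := by rw [star_smul, smul_mul_assoc, map_smul]; rfl

lemma IsState.norm_le_re_of_spreadable (hφ : IsState φ) {X : ℕ → PF d} {a : ℂ}
    (hX : ∀ i, star (X i) * X i = 1) (ha : ∀ i j, i < j → φ (star (X i) * X j) = a) :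
    ‖a‖ ≤ a.re := by
  let := InnerProductSpace.Core.toSeminormedAddCommGroup (c := hφ.preInnerCore)
  let := InnerProductSpace.ofCore hφ.preInnerCore
  refine Parafermion.norm_le_re_of_spreadable (ξ := X) (fun i => ?_) ha
  change φ (star (X i) * X i) = 1
  rw [hX, hφ.map_one]

lemma IsState.norm_sq_le_re_of_spreadable (hφ : IsState φ) {X : ℕ → PF d} {a t : ℂ}
    (hX : ∀ i, star (X i) * X i = 1) (ha : ∀ i j, i < j → φ (star (X i) * X j) = a)
    (ht : ∀ i, φ (X i) = t) : ‖t‖ ^ 2 ≤ a.re := by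
  let := InnerProductSpace.Core.toSeminormedAddCommGroup (c := hφ.preInnerCore)
  let := InnerProductSpace.ofCore hφ.preInnerCore
  refine Parafermion.norm_sq_le_re_of_spreadable (ξ := X) (v := 1) ?_ (fun i => ?_) ha
    (fun i => ?_)
  · change φ (star 1 * 1) = 1
    rw [star_one, mul_one, hφ.map_one]
  · change φ (star (X i) * X i) = 1
    rw [hX, hφ.map_one]
  · change φ (star 1 * X i) = t
    rw [star_one, one_mul, ht]

lemma eq_zero_of_norm_le_re {a r : ℂ} (hr : ‖r‖ = 1) (hr1 : r ≠ 1) (ha : ‖a‖ ≤ a.re)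
    (hb : ‖r * star a‖ ≤ (r * star a).re) : a = 0 := by
  have key : ∀ z : ℂ, ‖z‖ ≤ z.re → z = ‖z‖ := fun z hz => by
    have h := le_antisymm (Complex.re_le_norm z) hz
    exact (Complex.re_eq_norm.1 h |> Complex.nonneg_iff.1 |> fun h' =>
      Complex.ext (by simpa using h) (by simpa using h'.2.symm))
  have h1 := key _ ha
  have h2 := key _ hb
  rw [norm_mul, hr, one_mul, norm_star, h1] at h2
  simp only [Complex.star_def, Complex.conj_ofReal, Complex.norm_real, norm_norm] at h2
  have h3 : (r - 1) * (‖a‖ : ℂ) = 0 := by rw [sub_mul, h2, one_mul, sub_self]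
  have h4 := (mul_eq_zero.1 h3).resolve_left (sub_ne_zero.2 hr1)
  rw [h1, h4]

lemma IsState.map_monomial_eq_zero (hd : Squarefree d) {s : ℂ} (hs : s ≠ 0) (hφ : IsState φ)
    (hinv : IsBraidInvariant s φ) {l : List ℕ} (hl : ¬ d ∣ l.length) : φ (monomial d l) = 0 := by
  have hd0 : d ≠ 0 := hd.ne_zero
  obtain ⟨n, hn⟩ : ∃ n, ∀ j ∈ l, j < 2 * n := by
    obtain ⟨n, hn⟩ := l.toFinset.exists_nat_subset_range
    exact ⟨n, fun j hj => by
      have := Finset.mem_range.1 (hn (List.mem_toFinset.2 hj)); omega⟩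
  -- `X i` lives on the pairs `n * i, …, n * i + n - 1`, so distinct translates occupy disjoint
  -- blocks.
  let X : ℕ → PF d := fun i => reindex d _ (gap_strictMono 0 (n * i)) (monomial d l)
  have hX : ∀ i, X i = monomial d (l.map (gap 0 (n * i))) := fun i => reindex_monomial _ _
  have hmove : ∀ i m, i ≤ m → reindex d _ (gap_strictMono 0 (n * i)) (X (m - i)) = X m := by
    intro i m him
    obtain ⟨p, rfl⟩ := Nat.exists_eq_add_of_le him
    rw [hX, hX, reindex_monomial, List.map_map]
    congr 2
    funext j
    simp [gap]
    ring
  have ha : ∀ i j, i < j → φ (star (X i) * X j) = φ (star (X 0) * X 1) := by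
    intro i j hij
    -- Undo the common shift, reducing blocks `(i, j)` to `(0, j - i)`.
    rw [← hmove i i le_rfl, ← hmove i j hij.le, ← reindex_star,
      ← map_mul (reindex d _ (gap_strictMono 0 (n * i))),
      hinv.reindex_gap hd0 hs, Nat.sub_self]
    -- Inserting `n * (j - i - 1)` pairs just after block `0` fixes it and carries block `1` to
    -- block `j - i`.
    rw [← hinv.reindex_gap hd0 hs n (n * (j - i - 1)) (star (X 0) * X 1),
      map_mul (reindex d _ _), reindex_star,
      hX, hX, hX, reindex_monomial, reindex_monomial, List.map_map, List.map_map]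
    obtain ⟨p, rfl⟩ := Nat.exists_eq_add_of_lt hij
    congr 4
    · refine List.map_congr_left fun k hk => ?_
      have := hn k hk
      simp [gap, this]
    · funext k
      simp [gap, show i + p + 1 - i = p + 1 by omega]
      ring
  have hswap : ∀ i j, i < j →
      star (X j) * X i = q d ^ (l.length * l.length) • (X i * star (X j)) := by
    intro i j hij
    have h1 : X i * X j = q d ^ (l.length * l.length) • (X j * X i) := by
      rw [hX, hX, monomial_mul_monomial]
      · simp
      · simp only [List.mem_map]
        rintro _ ⟨a, ha, rfl⟩ _ ⟨b, hb, rfl⟩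
        obtain ⟨p, rfl⟩ := Nat.exists_eq_add_of_lt hij
        have := hn a ha
        simp only [gap, Nat.mul_zero, Nat.not_lt_zero, if_false]
        nlinarith [Nat.zero_le (n * p)]
    have h2 : star (X j) * X j = 1 := by rw [hX]; exact star_monomial_mul_self _
    have h3 : X j * star (X j) = 1 := by rw [hX]; exact monomial_mul_star_self _
    have h4 := congrArg (fun x => star (X j) * x * star (X j)) h1
    simp only [mul_smul_comm, smul_mul_assoc] at h4
    rwa [mul_assoc, mul_assoc, h3, mul_one, ← mul_assoc (star (X j)), h2, one_mul] at h4
  set r := q d ^ (l.length * l.length) with hr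
  have hr0 : r ≠ 0 := pow_ne_zero _ (q_ne_zero d)
  have hprim := q_isPrimitiveRoot hd0
  -- Square-freeness enters here: `d ∣ L²` would imply `d ∣ L`.
  have hr1 : r ≠ 1 := by
    rw [hr, Ne, hprim.pow_eq_one_iff_dvd, ← sq, hd.dvd_pow_iff_dvd two_ne_zero]
    exact hl
  have hrn : ‖r‖ = 1 := by rw [hr, norm_pow, hprim.norm'_eq_one hd0, one_pow]
  -- The adjoints are spreadable too: conjugating `a` reverses the factors, and restoring their
  -- order costs the phase `r⁻¹`.
  have hb : ∀ i j, i < j →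
      φ (star (star (X i)) * star (X j)) = r⁻¹ * star (φ (star (X 0) * X 1)) := by
    intro i j hij
    rw [star_star, ← ha i j hij, ← hφ.map_star, star_mul, star_star, hswap i j hij, map_smul,
      smul_eq_mul, inv_mul_cancel_left₀ hr0]
  have hX1 : ∀ i, star (X i) * X i = 1 := fun i => by rw [hX]; exact star_monomial_mul_self _
  have hX2 : ∀ i, star (star (X i)) * star (X i) = 1 := fun i => by
    rw [hX, star_star]; exact monomial_mul_star_self _
  have h0 := eq_zero_of_norm_le_re (r := r⁻¹) (by rw [norm_inv, hrn, inv_one]) (by simpa using hr1)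
    (hφ.norm_le_re_of_spreadable hX1 ha) (hφ.norm_le_re_of_spreadable hX2 hb)
  have h1 := hφ.norm_sq_le_re_of_spreadable hX1 ha
    (fun i => hinv.reindex_gap hd0 hs 0 (n * i) (monomial d l))
  rw [h0, Complex.zero_re] at h1
  exact norm_eq_zero.1 (pow_eq_zero_iff two_ne_zero |>.1 (le_antisymm h1 (sq_nonneg _)))

end States

end Parafermion

theorem mainTheorem3 (d : ℕ) (hd : Squarefree d)
    (ζ : ℂ) (hζ : ζ ^ 2 = Parafermion.q d) (hζd : ζ ^ (d ^ 2) = 1)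
    (s : ℂ) (hs : s ^ 2 = Parafermion.omega d ζ)
    (φ : Parafermion.PF d →ₗ[ℂ] ℂ) (hφ : Parafermion.IsState φ)
    (hinv : Parafermion.IsBraidInvariant s φ) :
    Parafermion.IsNeutral φ := by
  have hd0 : d ≠ 0 := hd.ne_zero
  have hs0 : s ≠ 0 := by
    rintro rfl
    rw [zero_pow two_ne_zero, Parafermion.omega, eq_comm, mul_eq_zero, inv_eq_zero,
      Complex.ofReal_eq_zero, Real.sqrt_eq_zero (Nat.cast_nonneg _), Nat.cast_eq_zero] at hs
    exact hs.elim hd0 (Parafermion.gauss_sum_ne_zero hd0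
      (hζ ▸ Parafermion.q_isPrimitiveRoot hd0) hζd)
  intro k hk x hx
  induction hx using Submodule.span_induction with
  | mem x hx =>
    obtain ⟨l, hl, rfl⟩ := hx
    refine hφ.map_monomial_eq_zero hd hs0 hinv fun hdvd => hk ?_
    rw [← hl, ZMod.natCast_eq_zero_iff]
    exact hdvd
  | zero => exact map_zero φ
  | add x y _ _ hx hy => rw [map_add, hx, hy, add_zero]
  | smul z x _ hx => rw [map_smul, hx, smul_zero]
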